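/- All graphs are finite, simple and undirected. A fractional matching of a graph $G$ is a function $f:E(G)\to[0,1]$ with $\sum_{e\ni v}f(e)\le 1$ for every vertex $v$; it is perfect if $\sum_{e\ni v}f(e)=1$ for every vertex $v$. The fractional matching preclusion number $fmp(G)$ is the minimum of $|F|$ over all $F\subseteq E(G)$ such that $G-F$ has no fractional perfect matching. Let $g(n,k)$ be the maximum integer such that every graph $G$ of order $n$ with $|E(G)|\le g(n,k)$ satisfies $fmp(G)\le k$, and let $s(n,k)$ be the minimum number of edges of a graph $G$ of order $n$ with $fmp(G)=k$. Let $n,k$ be positive integers with $n=\ell(k+2)+r$, where $0\le r\le k+1$, $k\ge 5$ and $k+2\le n$ (that is, $\ell\ge 1$). Then $g(n,k)$ and $s(n,k+1)$ exist, $g(n,k)=s(n,k+1)-1$, and the following hold. (1) If (a) $r=0$, or (b) $r\ge 1$ and $k+r+1$ is odd, or (c) $r\ge1$, $k+r+1$ is even, $k$ is odd and $\ell\ge 2$, then $$g(n,k)=\frac{n(k+1)}{2}-1.$$ (2) If $r\ge 1$, $k+r+1$ is even, $k$ is even and $\ell\ge 2$, then $$g(n,k)=\frac{n(k+1)+1}{2}-1.$$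 (3) If $r\ge 1$, $k+r+1$ is even, $\ell=1$ and $k\le n-3$, then $$\left\lceil\frac{n(k+1)}{2}\right\rceil-1\le g(n,k)\le\frac{(n-1)(k+3)}{2}-1.$$ -/

import Mathlib

namespace FMP

variable {V : Type*} [Fintype V]

open Classical in
/-- A fractional matching of `G`: a weight in `[0,1]` on every edge, such that at every vertex the
weights of the incident edges sum to at most `1`. (Values of `f` outside `G.edgeSet` play no
role.) -/
def IsFractionalMatching (G : SimpleGraph V) (f : Sym2 V → ℝ) : Prop :=
  (∀ e ∈ G.edgeSet, f e ∈ Set.Icc (0 : ℝ) 1) ∧ ∀ v : V, ∑ e ∈ G.incidenceFinset v, f e ≤ 1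

open Classical in
/-- A fractional perfect matching: the sum at every vertex is exactly `1`. -/
def IsFractionalPerfectMatching (G : SimpleGraph V) (f : Sym2 V → ℝ) : Prop :=
  IsFractionalMatching G f ∧ ∀ v : V, ∑ e ∈ G.incidenceFinset v, f e = 1

/-- `F` is a set of edges of `G` whose deletion leaves no fractional perfect matching. -/
def IsFMPSet (G : SimpleGraph V) (F : Finset (Sym2 V)) : Prop :=
  (F : Set (Sym2 V)) ⊆ G.edgeSet ∧
    ¬ ∃ f : Sym2 V → ℝ, IsFractionalPerfectMatching (G.deleteEdges (F : Set (Sym2 V))) f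

/-- The fractional matching preclusion number: the least size of an FMP set. (If `V` is nonempty,
the set of all edges is an FMP set, so this is a minimum over a nonempty set.) -/
noncomputable def fmp (G : SimpleGraph V) : ℕ :=
  sInf {m : ℕ | ∃ F : Finset (Sym2 V), IsFMPSet G F ∧ F.card = m}

/-- The integers `m` such that every graph of order `n` with at most `m` edges has `fmp ≤ k`. -/
def gSet (n k : ℕ) : Set ℤ :=
  {m : ℤ | ∀ G : SimpleGraph (Fin n), (G.edgeSet.ncard : ℤ) ≤ m → fmp G ≤ k}

/-- `g(n,k)`, the largest element of `gSet n k` (only meaningful if there is one). -/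
noncomputable def g (n k : ℕ) : ℤ := sSup (gSet n k)

/-- The numbers of edges of the graphs of order `n` with `fmp` equal to `k`. -/
def sSet (n k : ℕ) : Set ℕ :=
  {m : ℕ | ∃ G : SimpleGraph (Fin n), fmp G = k ∧ G.edgeSet.ncard = m}

/-- `s(n,k)`, the smallest element of `sSet n k` (only meaningful if there is one). -/
noncomputable def s (n k : ℕ) : ℕ := sInf (sSet n k)

end FMP

/-! Deleting a vertex star kills every fractional perfect matching, so `fmp` is at most the minimum
degree and `fmp G ≥ k + 1` forces at least `n(k+1)/2` edges. Since deleting one edge lowers `fmp` by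
at most one, an edge-minimal graph with `fmp ≥ k + 1` attains equality; hence `g(n,k) = s(n,k+1) -
1`, and only sparse examples remain to be built.

A permutation moving every vertex along an edge yields a fractional perfect matching with
half-integral weights, so `Resilient G d` bounds `fmp` below. For even `n`, a union of `k + 1`
disjoint one-factors is optimal. For odd `n`, the cone over `k + 1` one-factors gives the bound in
(3). A cone of order close to `k` needs only `k` one-factors (`cone_resilient_succ`, by Hall's
theorem and counting); joined disjointly with an even block when `n` is larger, it is optimal in (1)
and (2). -/

namespace FMP

/-! ### Permutations, fractional matchings and the degree bound -/

section Basic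

variable {V : Type*} [Fintype V]

open Classical in
theorem two_mul_ncard_edgeSet (G : SimpleGraph V) :
    2 * G.edgeSet.ncard = ∑ v, (Finset.univ.filter (G.Adj v)).card := by
  rw [← SimpleGraph.coe_edgeFinset, Set.ncard_coe_finset,
    ← SimpleGraph.sum_degrees_eq_twice_card_edges]
  refine Finset.sum_congr rfl fun v _ => ?_
  rw [← SimpleGraph.card_neighborFinset_eq_degree, SimpleGraph.neighborFinset_eq_filter]

/-- `G` is `d`-resilient if after deleting fewer than `d` edges some permutation of the vertices
still moves every vertex along an edge. -/
def Resilient (G : SimpleGraph V) (d : ℕ) : Prop :=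
  ∀ F : Finset (Sym2 V), F.card < d →
    ∃ σ : Equiv.Perm V, ∀ v, G.Adj v (σ v) ∧ s(v, σ v) ∉ F

-- Each arc from `v` to `σ v` contributes weight 1/2. Every vertex lies on one outgoing and one
-- incoming arc; the two arcs of a 2-cycle share an edge, which gets weight 1.
open Classical in
theorem exists_fractionalPerfectMatching_of_perm (G : SimpleGraph V) (σ : Equiv.Perm V)
    (hσ : ∀ v, G.Adj v (σ v)) : ∃ f, IsFractionalPerfectMatching G f := by
  let f : Sym2 V → ℝ := fun e => ∑ u, if s(u, σ u) = e then (1 / 2 : ℝ) else 0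
  have hsum (v : V) : ∑ e ∈ G.incidenceFinset v, f e = 1 := by
    have hu (u : V) : (∑ e ∈ G.incidenceFinset v, if s(u, σ u) = e then (1 / 2 : ℝ) else 0) =
        (if u = v then 1 / 2 else 0) + (if u = σ.symm v then 1 / 2 else 0) := by
      have hne : v ≠ σ.symm v := fun h => by
        have := hσ v
        rw [(Equiv.eq_symm_apply σ).1 h] at this
        exact G.irrefl this
      rw [Finset.sum_ite_eq]
      have hmem : s(u, σ u) ∈ G.incidenceFinset v ↔ u = v ∨ u = σ.symm v := by
        rw [SimpleGraph.mem_incidenceFinset, SimpleGraph.mk'_mem_incidenceSet_iff,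
          Equiv.eq_symm_apply]
        simp only [hσ u, true_and, eq_comm]
      by_cases h1 : u = v
      · have h2 : u ≠ σ.symm v := h1 ▸ hne
        rw [if_pos (hmem.2 (Or.inl h1)), if_pos h1, if_neg h2, add_zero]
      · by_cases h2 : u = σ.symm v
        · rw [if_pos (hmem.2 (Or.inr h2)), if_neg h1, if_pos h2, zero_add]
        · rw [if_neg (fun h => (hmem.1 h).elim h1 h2), if_neg h1, if_neg h2, add_zero]
    calc ∑ e ∈ G.incidenceFinset v, f e
        = ∑ u, ∑ e ∈ G.incidenceFinset v, (if s(u, σ u) = e then (1 / 2 : ℝ) else 0) :=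
          Finset.sum_comm
      _ = ∑ u, ((if u = v then (1 / 2 : ℝ) else 0) + (if u = σ.symm v then 1 / 2 else 0)) :=
          Finset.sum_congr rfl fun u _ => hu u
      _ = 1 := by
          rw [Finset.sum_add_distrib, Finset.sum_ite_eq', Finset.sum_ite_eq']
          norm_num
  have hnn (e : Sym2 V) : 0 ≤ f e :=
    Finset.sum_nonneg fun u _ => by split_ifs <;> norm_num
  refine ⟨f, ⟨fun e he => ⟨hnn e, ?_⟩, fun v => (hsum v).le⟩, hsum⟩
  -- The weight of an edge is one nonnegative term of the sum at an endpoint, which is 1.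
  induction e using Sym2.ind with
  | _ a b =>
    rw [← hsum a]
    refine Finset.single_le_sum (f := f) (fun e _ => hnn e) ?_
    rw [SimpleGraph.mem_incidenceFinset]
    exact ⟨he, Sym2.mem_mk_left a b⟩

open Classical in
/-- Deleting all edges at a vertex destroys all fractional perfect matchings. -/
theorem isFMPSet_incidenceFinset (G : SimpleGraph V) (v : V) :
    IsFMPSet G (G.incidenceFinset v) := by
  refine ⟨fun e he => ?_, ?_⟩
  · exact ((G.mem_incidenceFinset v e).1 (by simpa using he)).1
  · rintro ⟨f, -, hf⟩
    have h := hf v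
    rw [Finset.sum_eq_zero, eq_comm] at h
    · exact one_ne_zero h
    · intro e he
      rw [SimpleGraph.mem_incidenceFinset] at he
      have h1 := he.1
      rw [SimpleGraph.edgeSet_deleteEdges] at h1
      exact absurd (by simpa using (G.mem_incidenceFinset v e).2 ⟨h1.1, he.2⟩) h1.2

theorem fmp_le_card {G : SimpleGraph V} {F : Finset (Sym2 V)} (h : IsFMPSet G F) :
    fmp G ≤ F.card := Nat.sInf_le ⟨F, h, rfl⟩

theorem exists_isFMPSet_card_eq_fmp [Nonempty V] (G : SimpleGraph V) :
    ∃ F, IsFMPSet G F ∧ F.card = fmp G := by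
  classical
  exact Nat.sInf_mem (s := {m : ℕ | ∃ F : Finset (Sym2 V), IsFMPSet G F ∧ F.card = m})
    ⟨_, _, isFMPSet_incidenceFinset G (Classical.arbitrary V), rfl⟩

theorem Resilient.le_fmp [Nonempty V] {G : SimpleGraph V} {d : ℕ} (h : Resilient G d) :
    d ≤ fmp G := by
  obtain ⟨F, hF, hcard⟩ := exists_isFMPSet_card_eq_fmp G
  by_contra! hlt
  obtain ⟨σ, hσ⟩ := h F (hcard ▸ hlt)
  refine hF.2 (exists_fractionalPerfectMatching_of_perm _ σ fun v => ?_)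
  rw [SimpleGraph.deleteEdges_adj]
  exact ⟨(hσ v).1, by simpa using (hσ v).2⟩

open Classical in
theorem card_mul_fmp_le (G : SimpleGraph V) : Fintype.card V * fmp G ≤ 2 * G.edgeSet.ncard := by
  rw [two_mul_ncard_edgeSet, ← Finset.card_univ, ← smul_eq_mul]
  refine Finset.card_nsmul_le_sum _ _ _ fun v _ => ?_
  refine (fmp_le_card (isFMPSet_incidenceFinset G v)).trans ?_
  rw [SimpleGraph.card_incidenceFinset_eq_degree, ← SimpleGraph.card_neighborFinset_eq_degree,
    SimpleGraph.neighborFinset_eq_filter]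

/-- An optimal set for the smaller graph, enlarged by `e`, works for `G`. -/
theorem fmp_le_fmp_deleteEdges_add_one [Nonempty V] (G : SimpleGraph V) {e : Sym2 V}
    (he : e ∈ G.edgeSet) : fmp G ≤ fmp (G.deleteEdges {e}) + 1 := by
  classical
  obtain ⟨F, hF, hcard⟩ := exists_isFMPSet_card_eq_fmp (G.deleteEdges {e})
  rw [← hcard]
  refine (fmp_le_card (F := insert e F) ⟨?_, ?_⟩).trans (Finset.card_insert_le _ _)
  · intro x hx
    rcases Finset.mem_insert.1 (Finset.mem_coe.1 hx) with rfl | hx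
    · exact he
    · have := hF.1 (Finset.mem_coe.2 hx)
      rw [SimpleGraph.edgeSet_deleteEdges] at this
      exact this.1
  · have h := hF.2
    rwa [SimpleGraph.deleteEdges_deleteEdges, Set.singleton_union, ← Finset.coe_insert] at h

theorem ncard_edgeSet_deleteEdges_singleton (G : SimpleGraph V) {e : Sym2 V}
    (he : e ∈ G.edgeSet) : (G.deleteEdges {e}).edgeSet.ncard + 1 = G.edgeSet.ncard := by
  rw [SimpleGraph.edgeSet_deleteEdges]
  exact Set.ncard_sdiff_singleton_add_one he (Set.toFinite _)

end Basic

/-! ### Relabelling and disjoint unions -/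

section Transport

variable {V W : Type*}

theorem Resilient.comap {G : SimpleGraph W} {d : ℕ} (h : Resilient G d) (e : V ≃ W) :
    Resilient (G.comap e) d := by
  classical
  intro F hF
  obtain ⟨σ, hσ⟩ := h (F.image (Sym2.map e)) (Finset.card_image_le.trans_lt hF)
  refine ⟨(e.trans σ).trans e.symm, fun v => ⟨?_, fun hmem => (hσ (e v)).2 ?_⟩⟩
  · simpa using (hσ (e v)).1
  · exact Finset.mem_image.2 ⟨_, hmem, by simp⟩

theorem ncard_edgeSet_comap (G : SimpleGraph W) (e : V ≃ W) :
    (G.comap e).edgeSet.ncard = G.edgeSet.ncard :=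
  Nat.card_congr (SimpleGraph.Iso.comap e G).mapEdgeSet

theorem Resilient.sum {G : SimpleGraph V} {H : SimpleGraph W} {d : ℕ} (hG : Resilient G d)
    (hH : Resilient H d) : Resilient (G.sum H) d := by
  classical
  intro F hF
  have hl : Function.Injective (Sym2.map (Sum.inl : V → V ⊕ W)) :=
    Sym2.map.injective Sum.inl_injective
  have hr : Function.Injective (Sym2.map (Sum.inr : W → V ⊕ W)) :=
    Sym2.map.injective Sum.inr_injective
  have hcl : (F.preimage _ hl.injOn).card ≤ F.card :=
    Finset.card_le_card_of_injOn _ (fun x hx => Finset.mem_preimage.1 hx) hl.injOn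
  have hcr : (F.preimage _ hr.injOn).card ≤ F.card :=
    Finset.card_le_card_of_injOn _ (fun x hx => Finset.mem_preimage.1 hx) hr.injOn
  obtain ⟨σ, hσ⟩ := hG _ (hcl.trans_lt hF)
  obtain ⟨τ, hτ⟩ := hH _ (hcr.trans_lt hF)
  refine ⟨Equiv.sumCongr σ τ, ?_⟩
  rintro (v | w)
  · exact ⟨by simpa using (hσ v).1, by simpa using (hσ v).2⟩
  · exact ⟨by simpa using (hτ w).1, by simpa using (hτ w).2⟩

theorem ncard_edgeSet_sum [Finite V] [Finite W] (G : SimpleGraph V) (H : SimpleGraph W) :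
    (G.sum H).edgeSet.ncard = G.edgeSet.ncard + H.edgeSet.ncard := by
  have h := Nat.card_congr (SimpleGraph.edgeSetSumEquiv (G := G) (H := H))
  rwa [Nat.card_sum] at h

end Transport

/-! ### One-factorizations of complete graphs -/

section OneFactors

/-- A family of pairwise edge-disjoint one-factors of the complete graph on `V`, each given as a
fixed-point-free involution. -/
structure OneFactors (ι V : Type*) where
  perm : ι → Equiv.Perm V
  invol : ∀ i v, perm i (perm i v) = v
  ne_self : ∀ i v, perm i v ≠ v
  inj : ∀ v, Function.Injective fun i => perm i v

variable {ι V : Type*}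

/-- The union of a family of one-factors. -/
def OneFactors.graph (σ : OneFactors ι V) : SimpleGraph V where
  Adj u v := ∃ i, σ.perm i u = v
  symm := ⟨by
    rintro u v ⟨i, rfl⟩
    exact ⟨i, σ.invol i u⟩⟩
  loopless := ⟨by
    rintro v ⟨i, h⟩
    exact σ.ne_self i v h⟩

theorem OneFactors.eq_of_mk_eq (σ : OneFactors ι V) {i j : ι} {u v : V}
    (h : s(u, σ.perm i u) = s(v, σ.perm j v)) : i = j := by
  rcases Sym2.eq_iff.1 h with ⟨rfl, h⟩ | ⟨rfl, h⟩
  · exact σ.inj _ h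
  · refine σ.inj (σ.perm j v) ?_
    simp only [σ.invol]
    exact h

/-- Deleting a set `F` of edges damages at most `F.card` of the one-factors. -/
theorem OneFactors.card_damaged_le (σ : OneFactors ι V) [Fintype ι] (F : Finset (Sym2 V))
    (B : Finset ι) (hB : ∀ i ∈ B, ∃ v, s(v, σ.perm i v) ∈ F) : B.card ≤ F.card := by
  classical
  choose w hw using hB
  rw [← Finset.card_attach]
  exact Finset.card_le_card_of_injOn (fun i => s(w i i.2, σ.perm i (w i i.2)))
    (fun i _ => hw i i.2) fun i _ j _ h => Subtype.ext (σ.eq_of_mk_eq h)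

/-- With fewer deleted edges than factors, some factor stays intact, and its involution is the
permutation sought. -/
theorem OneFactors.resilient [Fintype V] [Fintype ι] (σ : OneFactors ι V) :
    Resilient σ.graph (Fintype.card ι) := by
  intro F hF
  by_contra! h
  have := σ.card_damaged_le F Finset.univ fun i _ => by
    obtain ⟨v, hv⟩ := h (σ.perm i)
    exact ⟨v, hv ⟨i, rfl⟩⟩
  rw [Finset.card_univ] at this
  omega

theorem OneFactors.card_neighbors [Fintype V] [Fintype ι] (σ : OneFactors ι V) (v : V)
    [DecidablePred (σ.graph.Adj v)] :
    (Finset.univ.filter (σ.graph.Adj v)).card = Fintype.card ι := by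
  classical
  rw [← Finset.card_univ, ← Finset.card_image_of_injective Finset.univ (σ.inj v)]
  congr 1
  ext w
  simp only [Finset.mem_filter, Finset.mem_image, Finset.mem_univ, true_and]
  rfl

theorem OneFactors.two_mul_ncard_edgeSet [Fintype V] [Fintype ι] (σ : OneFactors ι V) :
    2 * σ.graph.edgeSet.ncard = Fintype.card V * Fintype.card ι := by
  classical
  rw [FMP.two_mul_ncard_edgeSet, Finset.sum_congr rfl fun v _ => σ.card_neighbors v]
  simp

/-- The one-factorization of the complete graph on `ℤ/(2h+1) ∪ {∞}`. -/
theorem nonempty_oneFactors_option_zmod (h : ℕ) :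
    Nonempty (OneFactors (ZMod (2 * h + 1)) (Option (ZMod (2 * h + 1)))) := by
  -- Modulo `2h + 1` the inverse of 2 is `h + 1`.
  have half {a b : ZMod (2 * h + 1)} (hab : 2 * a = 2 * b) : a = b := by
    have h1 : ((h : ZMod (2 * h + 1)) + 1) * 2 = 1 := by
      have := ZMod.natCast_self (2 * h + 1)
      push_cast at this
      linear_combination this
    linear_combination ((h : ZMod (2 * h + 1)) + 1) * hab - (a - b) * h1
  -- Reflection about `c` fixes only `c`, which is matched with infinity instead.
  let p (c : ZMod (2 * h + 1)) : Option (ZMod (2 * h + 1)) → Option (ZMod (2 * h + 1))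
    | none => some c
    | some x => if x = c then none else some (2 * c - x)
  have hp (c : ZMod (2 * h + 1)) : Function.Involutive (p c) := by
    rintro (_ | x)
    · simp [p]
    · by_cases hx : x = c
      · simp [p, hx]
      · have : 2 * c - x ≠ c := fun h => hx (by linear_combination -h)
        simp [p, hx, this]
  refine ⟨⟨fun c => (hp c).toPerm, fun c => hp c, ?_, ?_⟩⟩
  · rintro c (_ | x)
    · simp [p]
    · by_cases hx : x = c
      · simp [p, hx]
      · have : 2 * c - x ≠ x := fun h => hx (half (by linear_combination -h))
        simp [p, hx, this]
  · rintro (_ | x) c c' hcc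
    · simpa [p] using hcc
    · by_cases hx : x = c <;> by_cases hx' : x = c'
      · exact hx.symm.trans hx'
      · simp [p, hx'] at hcc
        exact absurd hx hcc.1
      · simp [p, hx] at hcc
        exact absurd hx' hcc.1
      · have : 2 * c - x = 2 * c' - x := by simpa [p, hx, hx'] using hcc
        exact half (by linear_combination this)

theorem nonempty_oneFactors [Fintype V] (d : ℕ) (heven : Even (Fintype.card V))
    (hd : d < Fintype.card V) : Nonempty (OneFactors (Fin d) V) := by
  obtain ⟨m, hm⟩ := heven
  obtain ⟨h, rfl⟩ : ∃ h, m = h + 1 := ⟨m - 1, by omega⟩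
  obtain ⟨σ⟩ := nonempty_oneFactors_option_zmod h
  have e : V ≃ Option (ZMod (2 * h + 1)) := Fintype.equivOfCardEq (by
    rw [Fintype.card_option, ZMod.card]
    omega)
  obtain ⟨c⟩ : Nonempty (Fin d ↪ ZMod (2 * h + 1)) :=
    Function.Embedding.nonempty_of_card_le (by
      rw [Fintype.card_fin, ZMod.card]
      omega)
  refine ⟨⟨fun i => (e.trans (σ.perm (c i))).trans e.symm, fun i v => ?_, fun i v hv => ?_,
    fun v i j hij => ?_⟩⟩
  · simp [σ.invol]
  · refine σ.ne_self (c i) (e v) ?_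
    exact (Equiv.symm_apply_eq e).1 hv
  · exact c.injective (σ.inj (e v) (e.symm.injective hij))

end OneFactors

/-! ### Cones, for odd order -/

section Cone

variable {V : Type*}

/-- The cone over `G`: a new vertex joined to all vertices of `G`. -/
def cone (G : SimpleGraph V) : SimpleGraph (Option V) where
  Adj
    | none, none => False
    | some u, some v => G.Adj u v
    | _, _ => True
  symm := ⟨by
    rintro (_ | u) (_ | v) h
    exacts [h, trivial, trivial, SimpleGraph.Adj.symm h]⟩
  loopless := ⟨by
    rintro (_ | v) h
    exacts [h, G.irrefl h]⟩

theorem card_neighbors_cone_none [Fintype V] (G : SimpleGraph V)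
    [DecidablePred ((cone G).Adj none)] :
    (Finset.univ.filter ((cone G).Adj none)).card = Fintype.card V := by
  rw [← Finset.card_univ, ← Finset.card_map (s := (Finset.univ : Finset V)) Function.Embedding.some]
  congr 1
  refine Finset.ext ?_
  rintro (_ | w) <;> simp only [Finset.mem_filter, Finset.mem_univ, true_and] <;> simp [cone]

theorem card_neighbors_cone_some [Fintype V] (G : SimpleGraph V) (v : V)
    [DecidablePred ((cone G).Adj (some v))] [DecidablePred (G.Adj v)] :
    (Finset.univ.filter ((cone G).Adj (some v))).card =
      (Finset.univ.filter (G.Adj v)).card + 1 := by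
  classical
  rw [← Finset.card_insertNone]
  congr 1
  refine Finset.ext ?_
  rintro (_ | w) <;> simp only [Finset.mem_filter, Finset.mem_univ, true_and] <;> simp [cone]

theorem two_mul_ncard_edgeSet_cone [Fintype V] {ι : Type*} [Fintype ι] (σ : OneFactors ι V) :
    2 * (cone σ.graph).edgeSet.ncard = Fintype.card V * (Fintype.card ι + 2) := by
  classical
  rw [two_mul_ncard_edgeSet, Fintype.sum_option, card_neighbors_cone_none]
  simp only [card_neighbors_cone_some, σ.card_neighbors]
  simp
  ring

/-- Deleted spokes and damaged factors together number fewer than the factors. So some intact factor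
has an edge with both spokes present; that triangle absorbs the apex, and the factor handles the
other vertices. -/
theorem cone_resilient [Fintype V] {ι : Type*} [Fintype ι] (σ : OneFactors ι V)
    (hV : Fintype.card ι < Fintype.card V) :
    Resilient (cone σ.graph) (Fintype.card ι) := by
  classical
  intro F hF
  have hinj : Function.Injective (Sym2.map (some : V → Option V)) :=
    Sym2.map.injective (Option.some_injective V)
  let B : Finset V := Finset.univ.filter fun v => s(none, some v) ∈ F
  let F' : Finset (Sym2 V) := F.preimage _ hinj.injOn
  let D : Finset ι := Finset.univ.filter fun i => ∃ v, s(v, σ.perm i v) ∈ F'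
  have hD : D.card ≤ F'.card := σ.card_damaged_le F' D fun i hi => (Finset.mem_filter.1 hi).2
  have hBF : B.card + F'.card ≤ F.card := by
    have hmk : Function.Injective fun v : V => s(none, some v) := fun u v h => by
      simpa using h
    rw [← Finset.card_image_of_injective B hmk, ← Finset.card_image_of_injective F' hinj,
      ← Finset.card_union_of_disjoint]
    · refine Finset.card_le_card fun e he => ?_
      rcases Finset.mem_union.1 he with he | he
      · obtain ⟨v, hv, rfl⟩ := Finset.mem_image.1 he
        exact (Finset.mem_filter.1 hv).2
      · obtain ⟨x, hx, rfl⟩ := Finset.mem_image.1 he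
        exact Finset.mem_preimage.1 hx
    · rw [Finset.disjoint_left]
      intro e he he'
      obtain ⟨v, -, rfl⟩ := Finset.mem_image.1 he
      obtain ⟨x, -, hx⟩ := Finset.mem_image.1 he'
      have : (none : Option V) ∈ Sym2.map some x := by
        rw [hx]
        exact Sym2.mem_mk_left _ _
      simp at this
  obtain ⟨w, hw⟩ : ∃ w, w ∉ B := by
    by_contra! h
    have : B = Finset.univ := Finset.eq_univ_iff_forall.2 h
    rw [this, Finset.card_univ] at hBF
    omega
  obtain ⟨i, hi, hiB⟩ : ∃ i, i ∉ D ∧ σ.perm i w ∉ B := by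
    by_contra! h
    have h1 : Dᶜ.card ≤ B.card :=
      Finset.card_le_card_of_injOn (fun i => σ.perm i w)
        (fun i hi => h i (by simpa using hi)) (σ.inj w).injOn
    rw [Finset.card_compl] at h1
    omega
  have hiF (v : V) : s(some v, some (σ.perm i v)) ∉ F := fun hmem =>
    hi (Finset.mem_filter.2 ⟨Finset.mem_univ _, v, Finset.mem_preimage.2 (by simpa using hmem)⟩)
  have hwF : s(none, some w) ∉ F := fun h => hw (by simpa [B] using h)
  have hwF' : s(none, some (σ.perm i w)) ∉ F := fun h => hiB (by simpa [B] using h)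
  -- This is the 3-cycle from the apex to `σ.perm i w` to `w` and back, with `σ.perm i` elsewhere.
  refine ⟨(Equiv.swap none (some w)).trans (Equiv.optionCongr (σ.perm i)), ?_⟩
  rintro (_ | v)
  · simp only [Equiv.trans_apply, Equiv.swap_apply_left, Equiv.optionCongr_apply, Option.map_some]
    exact ⟨trivial, hwF'⟩
  · by_cases hv : v = w
    · subst hv
      simp only [Equiv.trans_apply, Equiv.swap_apply_right, Equiv.optionCongr_apply,
        Option.map_none]
      exact ⟨trivial, by rwa [Sym2.eq_swap]⟩
    · rw [Equiv.trans_apply, Equiv.swap_apply_of_ne_of_ne (by simp) (by simpa using hv)]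
      exact ⟨⟨i, rfl⟩, hiF v⟩

end Cone

/-! ### Resilience of dense graphs by Hall's theorem -/

section Dense

variable {V : Type*} [Fintype V]

open Classical in
/-- If no permutation moves every vertex along an edge of `G`, then some `I` has all of its
neighbours in a disjoint smaller set `S`; moreover `I` has exactly one vertex more than `S`. -/
theorem exists_deficient_of_forall_perm (G : SimpleGraph V)
    (h : ∀ σ : Equiv.Perm V, ∃ v, ¬ G.Adj v (σ v)) :
    ∃ I S : Finset V, Disjoint I S ∧ I.card = S.card + 1 ∧
      ∀ v ∈ I, ∀ w, G.Adj v w → w ∈ S := by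
  have hall := mt (Finset.all_card_le_biUnion_card_iff_exists_injective
    (fun v => Finset.univ.filter (G.Adj v))).1 (by
      rintro ⟨f, hf, hadj⟩
      obtain ⟨v, hv⟩ := h (Equiv.ofBijective f (Finite.injective_iff_bijective.1 hf))
      exact hv (by simpa using hadj v))
  push Not at hall
  obtain ⟨A, hA⟩ := hall
  set N := A.biUnion fun v => Finset.univ.filter (G.Adj v) with hN
  have memN {v w : V} (hv : v ∈ A) (hvw : G.Adj v w) : w ∈ N :=
    Finset.mem_biUnion.2 ⟨v, hv, by simpa using hvw⟩
  -- Cancelling the common part of `A` and `N` keeps the Hall deficiency. By symmetry of adjacency,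
  -- a vertex of `A \ N` has no neighbour in `A`.
  have hcard : (N \ A).card < (A \ N).card := by
    have h1 := Finset.card_sdiff_add_card_inter N A
    have h2 := Finset.card_sdiff_add_card_inter A N
    rw [Finset.inter_comm] at h2
    omega
  obtain ⟨I, hIA, hI⟩ := Finset.exists_subset_card_eq (Nat.succ_le_of_lt hcard)
  refine ⟨I, N \ A, ?_, hI, fun v hv w hvw => ?_⟩
  · exact (Finset.disjoint_sdiff (s := A) (t := N)).mono_left
      (hIA.trans Finset.sdiff_subset)
  · have hv' := Finset.mem_sdiff.1 (hIA hv)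
    exact Finset.mem_sdiff.2 ⟨memN hv'.1 hvw, fun hwA => hv'.2 (memN hwA hvw.symm)⟩

open Classical in
/-- Pairs of `F` meeting `I` are counted twice by their ends in `I` or once by each end. -/
theorem sum_card_add_two_mul_card_le (F : Finset (Sym2 V)) (I : Finset V) :
    ∑ v ∈ I, ((I.filter fun w => v ≠ w ∧ s(v, w) ∈ F).card +
      2 * (Iᶜ.filter fun w => v ≠ w ∧ s(v, w) ∈ F).card) ≤ 2 * F.card := by
  obtain ⟨H, hdef⟩ : ∃ H, H = SimpleGraph.fromEdgeSet (F : Set (Sym2 V)) := ⟨_, rfl⟩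
  have hadj (v w : V) : H.Adj v w ↔ v ≠ w ∧ s(v, w) ∈ F := by
    simp [hdef, SimpleGraph.fromEdgeSet_adj, and_comm]
  have hfilter (v : V) (T : Finset V) :
      (T.filter fun w => v ≠ w ∧ s(v, w) ∈ F) = T.filter (H.Adj v) :=
    Finset.filter_congr fun w _ => (hadj v w).symm
  have hH : H.edgeSet.ncard ≤ F.card := by
    rw [← Set.ncard_coe_finset]
    refine Set.ncard_le_ncard ?_ (Set.toFinite _)
    rw [hdef, SimpleGraph.edgeSet_fromEdgeSet]
    exact Set.sdiff_subset
  have hsplit (v : V) : (Finset.univ.filter (H.Adj v)).card =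
      (I.filter (H.Adj v)).card + (Iᶜ.filter (H.Adj v)).card := by
    rw [← Finset.card_union_of_disjoint
      (Finset.disjoint_filter_filter disjoint_compl_right), ← Finset.filter_union,
      Finset.union_compl]
  have hdouble : ∑ v ∈ I, (Iᶜ.filter (H.Adj v)).card = ∑ v ∈ Iᶜ, (I.filter (H.Adj v)).card := by
    have := Finset.sum_card_bipartiteAbove_eq_sum_card_bipartiteBelow (s := I) (t := Iᶜ) H.Adj
    refine Eq.trans ?_ (this.trans ?_)
    · rfl
    · refine Finset.sum_congr rfl fun v _ => ?_
      simp only [Finset.bipartiteBelow, H.adj_comm]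
  have htot := two_mul_ncard_edgeSet H
  rw [← Finset.sum_add_sum_compl I] at htot
  simp only [hsplit, Finset.sum_add_distrib] at htot
  simp only [hfilter, Finset.sum_add_distrib, ← Finset.mul_sum]
  omega

open Classical in
/-- A graph of minimum degree at least `d` and order close to `d` is `d`-resilient. -/
theorem resilient_of_dense (G : SimpleGraph V) (d : ℕ)
    (hdeg : ∀ v, d ≤ (Finset.univ.filter (G.Adj v)).card)
    (hcard : (Fintype.card V ≤ d + 1 ∧ 6 ≤ d) ∨ (Fintype.card V ≤ d + 2 ∧ 7 ≤ d)) :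
    Resilient G d := by
  intro F hF
  by_contra! hno
  obtain ⟨I, S, hdisj, hIS, hnbr⟩ := exists_deficient_of_forall_perm
    (G.deleteEdges (F : Set (Sym2 V))) (fun σ => by
      obtain ⟨v, hv⟩ := hno σ
      refine ⟨v, fun h => ?_⟩
      rw [SimpleGraph.deleteEdges_adj] at h
      exact h.2 (by simpa using hv h.1))
  have hle : I.card + S.card ≤ Fintype.card V := by
    rw [← Finset.card_union_of_disjoint hdisj]
    exact Finset.card_le_univ _
  have hx (v : V) (hv : v ∈ I) :
      (I.filter fun w => v ≠ w ∧ s(v, w) ∈ F).card ≤ S.card := by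
    have : (I.filter fun w => v ≠ w ∧ s(v, w) ∈ F) ⊆ I.erase v := fun w hw => by
      rw [Finset.mem_filter] at hw
      exact Finset.mem_erase.2 ⟨hw.2.1.symm, hw.1⟩
    have := Finset.card_le_card this
    rw [Finset.card_erase_of_mem hv] at this
    omega
  have hxy (v : V) (hv : v ∈ I) :
      d ≤ S.card + ((I.filter fun w => v ≠ w ∧ s(v, w) ∈ F).card +
        (Iᶜ.filter fun w => v ≠ w ∧ s(v, w) ∈ F).card) := by
    refine (hdeg v).trans ?_
    rw [← Finset.card_union_of_disjoint
      (Finset.disjoint_filter_filter disjoint_compl_right), ← Finset.filter_union,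
      Finset.union_compl]
    refine le_trans (Finset.card_le_card fun w hw => ?_) (Finset.card_union_le _ _)
    have hvw : G.Adj v w := (Finset.mem_filter.1 hw).2
    by_cases hF : s(v, w) ∈ F
    · exact Finset.mem_union_right _ (by simp [hF, hvw.ne])
    · refine Finset.mem_union_left _ (hnbr v hv w ?_)
      rw [SimpleGraph.deleteEdges_adj]
      exact ⟨hvw, by simpa using hF⟩
  have hsum := sum_card_add_two_mul_card_le F I
  have hlow (c : ℕ) (hc : ∀ v ∈ I, c ≤ (I.filter fun w => v ≠ w ∧ s(v, w) ∈ F).card +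
      2 * (Iᶜ.filter fun w => v ≠ w ∧ s(v, w) ∈ F).card) : (S.card + 1) * c < 2 * d := by
    have := Finset.card_nsmul_le_sum I _ c hc
    rw [smul_eq_mul, hIS] at this
    omega
  -- With `x` deleted pairs inside `I` and `y` leaving it at a vertex, `x + y ≥ d - s` and `x ≤ s`.
  -- Thus `x + 2y` is at least both `d - s` and `2(d - s) - s`.
  have h1 := hlow (d - S.card) fun v hv => by
    have := hxy v hv
    omega
  have h2 := hlow (2 * (d - S.card) - S.card) fun v hv => by
    have := hxy v hv
    have := hx v hv
    omega
  generalize S.card = s at *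
  -- Here `(s + 1)c < 3s + c` contradicts `c ≥ 3`. Otherwise `2s + 1 ≤ |V|` leaves only `d = 7`, `s
  -- = 4`, excluded by `h1`; the second alternative below is vacuous.
  by_cases h3 : 3 * (s + 1) ≤ 2 * d
  · obtain ⟨c, hc⟩ : ∃ c, 2 * d = 3 * s + c := ⟨2 * d - 3 * s, by omega⟩
    have h4 : 2 * (d - s) - s = c := by omega
    rw [h4] at h2
    have : 3 ≤ c := by omega
    nlinarith
  · have : d = 7 ∧ s = 4 ∨ d = 8 ∧ s = 5 := by omega
    rcases this with ⟨rfl, rfl⟩ | ⟨rfl, rfl⟩ <;> omega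

/-- The spoke raises each base degree by one, so in this range of orders density gives one more unit
of resilience than `cone_resilient`. -/
theorem cone_resilient_succ {ι : Type*} [Fintype ι] (σ : OneFactors ι V)
    (hcard : (Fintype.card V = Fintype.card ι + 1 ∧ 5 ≤ Fintype.card ι) ∨
      (Fintype.card V = Fintype.card ι + 2 ∧ 6 ≤ Fintype.card ι)) :
    Resilient (cone σ.graph) (Fintype.card ι + 1) := by
  classical
  refine resilient_of_dense _ _ ?_ (by rw [Fintype.card_option]; omega)
  rintro (_ | v)
  · rw [card_neighbors_cone_none]
    omega
  · rw [card_neighbors_cone_some, σ.card_neighbors]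

end Dense

/-! ### Extremal graphs and the extremal numbers -/

section Extremal

theorem exists_resilient_of_even {n d : ℕ} (hn : Even n) (hd : d < n) :
    ∃ G : SimpleGraph (Fin n), Resilient G d ∧ 2 * G.edgeSet.ncard = n * d := by
  obtain ⟨σ⟩ := nonempty_oneFactors (V := Fin n) d (by simpa using hn) (by simpa using hd)
  exact ⟨σ.graph, by simpa using σ.resilient, by simpa using σ.two_mul_ncard_edgeSet⟩

theorem exists_resilient_cone {p d : ℕ} (hp : Even p) (hd : d < p) :
    ∃ G : SimpleGraph (Fin (p + 1)), Resilient G d ∧ 2 * G.edgeSet.ncard = p * (d + 2) := by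
  obtain ⟨σ⟩ := nonempty_oneFactors (V := Fin p) d (by simpa using hp) (by simpa using hd)
  have e : Fin (p + 1) ≃ Option (Fin p) := Fintype.equivOfCardEq (by simp)
  refine ⟨(cone σ.graph).comap e, ?_, ?_⟩
  · simpa using (cone_resilient σ (by simpa using hd)).comap e
  · rw [ncard_edgeSet_comap, two_mul_ncard_edgeSet_cone]
    simp

theorem exists_resilient_cone_succ {p d : ℕ} (hp : Even p)
    (hcard : (p = d + 1 ∧ 5 ≤ d) ∨ (p = d + 2 ∧ 6 ≤ d)) :
    ∃ G : SimpleGraph (Fin (p + 1)), Resilient G (d + 1) ∧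
      2 * G.edgeSet.ncard = p * (d + 2) := by
  obtain ⟨σ⟩ := nonempty_oneFactors (V := Fin p) d (by simpa using hp)
    (by rw [Fintype.card_fin]; omega)
  have e : Fin (p + 1) ≃ Option (Fin p) := Fintype.equivOfCardEq (by simp)
  refine ⟨(cone σ.graph).comap e, ?_, ?_⟩
  · simpa using (cone_resilient_succ σ (by simpa using hcard)).comap e
  · rw [ncard_edgeSet_comap, two_mul_ncard_edgeSet_cone]
    simp

theorem exists_resilient_add {m n d : ℕ}
    {a b : ℕ} (hG : ∃ G : SimpleGraph (Fin m), Resilient G d ∧ 2 * G.edgeSet.ncard = a)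
    (hH : ∃ H : SimpleGraph (Fin n), Resilient H d ∧ 2 * H.edgeSet.ncard = b) :
    ∃ G : SimpleGraph (Fin (m + n)), Resilient G d ∧ 2 * G.edgeSet.ncard = a + b := by
  obtain ⟨G, hG, rfl⟩ := hG
  obtain ⟨H, hH, rfl⟩ := hH
  refine ⟨(G.sum H).comap finSumFinEquiv.symm, (hG.sum hH).comap _, ?_⟩
  rw [ncard_edgeSet_comap, ncard_edgeSet_sum, mul_add]

/-- For odd order, a union of a small dense odd block and an even block. -/
theorem exists_resilient_of_odd {n k : ℕ} (hk : 5 ≤ k) (hn : Odd n)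
    (hnk : n = k + 2 ∨ 2 * k + 4 ≤ n) :
    ∃ G : SimpleGraph (Fin n), Resilient G (k + 1) ∧
      2 * G.edgeSet.ncard = n * (k + 1) + (if Odd k then 0 else 1) := by
  rcases Nat.even_or_odd k with hkp | hkp
  · have h2 : 2 * k + 4 ≤ n := by
      rcases hnk with rfl | h
      · exact absurd hn (by simpa [Nat.even_add_one, parity_simps] using hkp)
      · exact h
    -- In the cone of order `k + 3` only the apex exceeds degree `k + 1`, by one: this is the extra
    -- 1. The size bound gives `q ≥ k + 1`, and parity makes it strict.
    obtain ⟨q, rfl⟩ : ∃ q, n = k + 2 + 1 + q := ⟨n - (k + 3), by omega⟩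
    have hq : Even q := by
      obtain ⟨a, ha⟩ := hn
      obtain ⟨b, hb⟩ := hkp
      exact ⟨a - b - 1, by omega⟩
    obtain ⟨b, hb⟩ := hkp
    obtain ⟨G, hG, hcard⟩ := exists_resilient_add
      (exists_resilient_cone_succ (p := k + 2) (d := k) ⟨b + 1, by omega⟩ (by omega))
      (exists_resilient_of_even (n := q) (d := k + 1) hq (by
        obtain ⟨a, ha⟩ := hq
        omega))
    refine ⟨G, hG, ?_⟩
    rw [hcard, if_neg (by simpa using ⟨b, hb⟩)]
    ring
  · have hK := exists_resilient_cone_succ (p := k + 1) (d := k) (hkp.add_odd odd_one) (by omega)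
    rw [if_pos hkp]
    rcases hnk with rfl | h2
    · obtain ⟨G, hG, hcard⟩ := hK
      exact ⟨G, hG, by rw [hcard]; ring⟩
    · obtain ⟨q, rfl⟩ : ∃ q, n = k + 1 + 1 + q := ⟨n - (k + 2), by omega⟩
      have hq : Even q := by
        obtain ⟨a, ha⟩ := hn
        obtain ⟨b, hb⟩ := hkp
        exact ⟨a - b - 1, by omega⟩
      obtain ⟨G, hG, hcard⟩ := exists_resilient_add hK
        (exists_resilient_of_even (n := q) (d := k + 1) hq (by omega))
      exact ⟨G, hG, by rw [hcard]; ring⟩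

/-- The extremal numbers are governed by the fewest edges of a graph with `fmp G ≥ k + 1`. -/
theorem isGreatest_g_and_isLeast_s {n k : ℕ} (hn : 0 < n)
    (hex : ∃ G : SimpleGraph (Fin n), Resilient G (k + 1)) :
    ∃ m : ℕ, IsGreatest (gSet n k) (g n k) ∧ IsLeast (sSet n (k + 1)) (s n (k + 1)) ∧
      g n k = (m : ℤ) - 1 ∧ s n (k + 1) = m ∧ n * (k + 1) ≤ 2 * m ∧
      ∀ G : SimpleGraph (Fin n), Resilient G (k + 1) → m ≤ G.edgeSet.ncard := by
  have : Nonempty (Fin n) := ⟨⟨0, hn⟩⟩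
  -- With `≥` in place of equality, `m` lies in `gSet n k` exactly when it is below the minimum of
  -- `A`.
  let A : Set ℕ := {m | ∃ G : SimpleGraph (Fin n), k + 1 ≤ fmp G ∧ G.edgeSet.ncard = m}
  obtain ⟨G₀, hG₀⟩ := hex
  have hA : A.Nonempty := ⟨_, G₀, hG₀.le_fmp, rfl⟩
  obtain ⟨G, hG, hGm⟩ : sInf A ∈ A := Nat.sInf_mem hA
  have hmin (H : SimpleGraph (Fin n)) (hH : k + 1 ≤ fmp H) : sInf A ≤ H.edgeSet.ncard :=
    Nat.sInf_le ⟨H, hH, rfl⟩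
  have hlow : n * (k + 1) ≤ 2 * sInf A := by
    have := card_mul_fmp_le G
    rw [Fintype.card_fin, hGm] at this
    exact (Nat.mul_le_mul_left n hG).trans this
  have hg : IsGreatest (gSet n k) ((sInf A : ℕ) - 1 : ℤ) := by
    constructor
    · intro H hH
      by_contra! hlt
      have := hmin H hlt
      omega
    · intro m hm
      by_contra! hlt
      have := hm G (by omega)
      omega
  have hs : IsLeast (sSet n (k + 1)) (sInf A) := by
    constructor
    · refine ⟨G, le_antisymm ?_ hG, hGm⟩
      obtain ⟨e, he⟩ : G.edgeSet.Nonempty := by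
        rw [← Set.ncard_pos, hGm]
        nlinarith
      by_contra! hlt
      have h1 := fmp_le_fmp_deleteEdges_add_one G he
      have h2 := ncard_edgeSet_deleteEdges_singleton G he
      have h3 := hmin (G.deleteEdges {e}) (by omega)
      omega
    · rintro m ⟨H, hH, rfl⟩
      exact hmin H hH.ge
  have hgeq : g n k = (sInf A : ℕ) - 1 := hg.csSup_eq
  have hseq : s n (k + 1) = sInf A := hs.csInf_eq
  exact ⟨sInf A, hgeq ▸ hg, hseq ▸ hs, hgeq, hseq, hlow, fun H hH => hmin H hH.le_fmp⟩

end Extremal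

end FMP

/-! ### The parity cases -/

theorem corollary3p2 (n k ℓ r : ℕ) (hn : n = ℓ * (k + 2) + r) (hr : r ≤ k + 1)
    (hk : 5 ≤ k) (hkn : k + 2 ≤ n) :
    -- the extremal numbers exist and are related by `g(n,k) = s(n,k+1) - 1`
    IsGreatest (FMP.gSet n k) (FMP.g n k) ∧
    IsLeast (FMP.sSet n (k + 1)) (FMP.s n (k + 1)) ∧
    FMP.g n k = (FMP.s n (k + 1) : ℤ) - 1 ∧
    -- (1)
    ((r = 0 ∨ (1 ≤ r ∧ Odd (k + r + 1)) ∨ (1 ≤ r ∧ Even (k + r + 1) ∧ Odd k ∧ 2 ≤ ℓ)) →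
      (FMP.g n k : ℚ) = (n : ℚ) * ((k : ℚ) + 1) / 2 - 1) ∧
    -- (2)
    ((1 ≤ r ∧ Even (k + r + 1) ∧ Even k ∧ 2 ≤ ℓ) →
      (FMP.g n k : ℚ) = ((n : ℚ) * ((k : ℚ) + 1) + 1) / 2 - 1) ∧
    -- (3)
    ((1 ≤ r ∧ Even (k + r + 1) ∧ ℓ = 1 ∧ k + 3 ≤ n) →
      ⌈(n : ℚ) * ((k : ℚ) + 1) / 2⌉ - 1 ≤ FMP.g n k ∧
      (FMP.g n k : ℚ) ≤ ((n : ℚ) - 1) * ((k : ℚ) + 3) / 2 - 1) := by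
  have hcone (hodd : Odd n) (h : k + 3 ≤ n) : ∃ G : SimpleGraph (Fin n),
      FMP.Resilient G (k + 1) ∧ 2 * G.edgeSet.ncard = (n - 1) * (k + 3) := by
    obtain ⟨a, rfl⟩ := hodd
    exact FMP.exists_resilient_cone (p := 2 * a) (d := k + 1) (by simp) (by omega)
  have hex : ∃ G : SimpleGraph (Fin n), FMP.Resilient G (k + 1) := by
    rcases Nat.even_or_odd n with he | ho
    · obtain ⟨G, hG, -⟩ := FMP.exists_resilient_of_even (d := k + 1) he (by omega)
      exact ⟨G, hG⟩
    · rcases Nat.lt_or_ge n (k + 3) with h | h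
      · obtain ⟨G, hG, -⟩ := FMP.exists_resilient_of_odd hk ho (Or.inl (by omega))
        exact ⟨G, hG⟩
      · obtain ⟨G, hG, -⟩ := hcone ho h
        exact ⟨G, hG⟩
  obtain ⟨m, hgreat, hleast, hg, hs, hlow, hup⟩ :=
    FMP.isGreatest_g_and_isLeast_s (n := n) (k := k) (by omega) hex
  have hg' : (FMP.g n k : ℚ) = (m : ℚ) - 1 := by
    rw [hg]
    push_cast
    ring
  have hlarge (h : 2 ≤ ℓ) : 2 * k + 4 ≤ n := by nlinarith
  refine ⟨hgreat, hleast, by rw [hg, hs], fun h => ?_, fun h => ?_, fun h => ?_⟩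
  · have hm : 2 * m = n * (k + 1) := by
      refine le_antisymm ?_ hlow
      rcases Nat.even_or_odd n with he | ho
      · obtain ⟨G, hG, hcard⟩ := FMP.exists_resilient_of_even (d := k + 1) he (by omega)
        have := hup G hG
        omega
      -- In case (1) an odd order forces `k` to be odd: for even `k`, `r` would be odd and `k + r +
      -- 1` even, contrary to (a), (b) and (c).
      · have hkl : Odd k ∧ (n = k + 2 ∨ 2 * k + 4 ≤ n) := by
          have hl : 1 ≤ ℓ := by
            by_contra! hl
            obtain rfl : ℓ = 0 := by omega
            omega
          have hl' : ℓ = 1 ∨ 2 ≤ ℓ := by omega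
          rcases hl' with rfl | hl2
          · simp only [Nat.odd_iff, Nat.even_iff] at h ho ⊢
            omega
          · refine ⟨?_, Or.inr (hlarge hl2)⟩
            by_contra hko
            have hke : Even k := by simpa using hko
            have hr2 : Odd r := by
              have : Even (ℓ * (k + 2)) := (hke.add even_two).mul_left ℓ
              rw [hn] at ho
              exact (Nat.odd_add'.1 ho).2 this
            simp only [Nat.odd_iff, Nat.even_iff] at h hke hr2
            omega
        obtain ⟨G, hG, hcard⟩ := FMP.exists_resilient_of_odd hk ho hkl.2
        rw [if_pos hkl.1] at hcard
        have := hup G hG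
        omega
    have hmq : 2 * (m : ℚ) = n * (k + 1) := by exact_mod_cast hm
    rw [hg']
    linarith
  · obtain ⟨hr1, hkr, hke, hl⟩ := h
    have ho : Odd n := by
      have h1 : Even (ℓ * (k + 2)) := (hke.add even_two).mul_left ℓ
      rw [hn]
      refine h1.add_odd ?_
      rw [Nat.even_iff] at hkr hke
      rw [Nat.odd_iff]
      omega
    -- The degree bound is a half-integer here, so it rounds up to the edge count of the
    -- construction.
    have hprod : Odd (n * (k + 1)) := ho.mul hke.add_one
    obtain ⟨G, hG, hcard⟩ := FMP.exists_resilient_of_odd hk ho (Or.inr (hlarge hl))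
    rw [if_neg (by simpa using hke)] at hcard
    have hm : 2 * m = n * (k + 1) + 1 := by
      have := hup G hG
      obtain ⟨a, ha⟩ := hprod
      omega
    have hmq : 2 * (m : ℚ) = n * (k + 1) + 1 := by exact_mod_cast hm
    rw [hg']
    linarith
  · obtain ⟨hr1, hkr, rfl, hk3⟩ := h
    have ho : Odd n := by
      rw [Nat.even_iff] at hkr
      rw [Nat.odd_iff]
      omega
    constructor
    · rw [hg, sub_le_sub_iff_right, Int.ceil_le]
      have hmq : (n : ℚ) * (k + 1) ≤ 2 * m := by exact_mod_cast hlow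
      push_cast
      linarith
    · obtain ⟨G, hG, hcard⟩ := hcone ho hk3
      have hm : 2 * m ≤ (n - 1) * (k + 3) := by
        have := hup G hG
        omega
      obtain ⟨p, rfl⟩ : ∃ p, n = p + 1 := ⟨n - 1, by omega⟩
      have hmq : 2 * (m : ℚ) ≤ p * (k + 3) := by exact_mod_cast hm
      rw [hg']
      push_cast
      linarith
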